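/- Let $\zeta$ be the Riemann zeta function, and for integers $n\ge 0$, $k\ge 1$ let $H_n^{(k)}=\sum_{i=1}^n \frac1{i^k}$ (so $H_0^{(k)}=0$). For integers $n,k\ge 0$ let the De Moivre polynomial $\mathcal A_{n,k}(a_1,a_2,a_3,\dots)$ be the coefficient of $x^n$ in the formal power series $(a_1x+a_2x^2+a_3x^3+\cdots)^k$. Then for every integer $m\ge 0$, each of the infinite series over $n$ below (one for each $0\le \ell\le m$) converges absolutely, and $$\sum_{\ell=0}^m (-1)^{m-\ell}\,\frac{2^\ell}{\ell!}\sum_{n=0}^\infty \frac{1}{(n+1)^2}\,\mathcal A_{m,\ell}\left(\frac{H_n^{(1)}}{1},\frac{H_n^{(2)}}{2},\frac{H_n^{(3)}}{3},\dots\right)=\sum_{j=0}^{m+2}\frac{1}{j!}\,\mathcal A_{m+2,j}\left(0,(2^2-2)\frac{\zeta(2)}{2},(2^3-2)\frac{\zeta(3)}{3},(2^4-2)\frac{\zeta(4)}{4},\dots\right).$$ -/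

import Mathlib

/-- The De Moivre polynomial `A_{n,k}(a 1, a 2, a 3, …)`: the coefficient of `x ^ n` in the formal
power series `(a 1 * x + a 2 * x ^ 2 + a 3 * x ^ 3 + ⋯) ^ k`. The sequence is indexed from `1`;
the value `a 0` is not used. -/
noncomputable def deMoivre {R : Type*} [CommRing R] (n k : ℕ) (a : ℕ → R) : R :=
  PowerSeries.coeff n ((PowerSeries.mk fun i => if i = 0 then 0 else a i) ^ k)

/-- The harmonic number `H_n^{(k)} = 1 / 1 ^ k + 1 / 2 ^ k + ⋯ + 1 / n ^ k` of order `k`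
with `n` summands. -/
noncomputable def harmonicNumber (k n : ℕ) : ℝ :=
  ∑ i ∈ Finset.Icc 1 n, 1 / (i : ℝ) ^ k

/-- The sequence `0, (2 ^ 2 - 2) ζ(2) / 2, (2 ^ 3 - 2) ζ(3) / 3, (2 ^ 4 - 2) ζ(4) / 4, …`,
indexed from `1` (the value at `0` is irrelevant). -/
noncomputable def gaussZetaSeq (i : ℕ) : ℂ :=
  if i ≤ 1 then 0 else (2 ^ i - 2) * riemannZeta (i : ℂ) / (i : ℂ)

/-!
The argument is an identity of formal power series over `ℝ`, read off in degree `m + 2`.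

For a sequence `a` write `E(a) = exp (a 1 * X + a 2 * X ^ 2 + ⋯)` (`expSeries`); its coefficients
are sums of De Moivre polynomials divided by factorials. The series `E(a)` is determined by its
logarithmic derivative (`eq_of_derivative_eq_mul`), so that `E(a + b) = E(a) E(b)` and
`E(-c ^ k / k) = 1 - c X`. Hence the combination of De Moivre polynomials of harmonic numbers on the
left of the theorem is the coefficient of `X ^ m` in `((1 + X) (1 + X / 2) ⋯ (1 + X / n)) ^ 2`
(`coeff_harmonicProd_sq`). Since `X (1 + X) ⋯ (1 + X / n) / (n + 1)` is `(X)_{n + 1} / (n + 1)!`,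
the left side is the coefficient of `X ^ (m + 2)` in the hypergeometric series
`₂F₁(X, X; 1; 1) = ∑ n, ((X)_n / n!) ^ 2`.

Its value is given by a formal version of Gauss's summation theorem, with coefficientwise
convergence in place of analytic functions. Gauss's contiguous relation
`(1 - 2 X / c) ₂F₁(X, X; c; 1) = (1 - X / c) ^ 2 ₂F₁(X, X; c + 1; 1)` follows from a telescoping
certificate (`gaussTerm_contiguous`). Iterating it expresses `₂F₁(X, X; 1; 1)` as
`∏ i ≤ N, (1 - X / i) ^ 2 / (1 - 2 X / i)` times `₂F₁(X, X; N + 1; 1)` (`gaussSeries_zero_eq`).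
The product is `E((2 ^ k - 2) H_N^{(k)} / k)`, which tends to `E((2 ^ k - 2) ζ(k) / k)`, because the
coefficient vanishes at `k = 1`; the last factor tends to `1` (`tendsto_gaussSeries`).

All convergence rests on one estimate: a De Moivre polynomial of the harmonic numbers of index `n`
is bounded by a power of `1 + log (n + 1)`, hence by a multiple of `(n + 1) ^ (1 / 2)`
(`exists_abs_deMoivre_harmonicNumber_le`).
-/

open PowerSeries Filter Topology

/-! ### The exponential of a formal power series -/

/-- The power series `a 1 * X + a 2 * X ^ 2 + ⋯` whose powers define the De Moivre polynomials. -/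
noncomputable def tailSeries {R : Type*} [CommRing R] (a : ℕ → R) : PowerSeries R :=
  PowerSeries.mk fun i => if i = 0 then 0 else a i

/-- The formal exponential `∑ j, (a 1 * X + a 2 * X ^ 2 + ⋯) ^ j / j!`. In degree `m` only the
powers `j ≤ m` contribute, so each coefficient is a finite sum. -/
noncomputable def expSeries (a : ℕ → ℝ) : PowerSeries ℝ :=
  PowerSeries.mk fun m => ∑ j ∈ Finset.range (m + 1), 1 / (j.factorial : ℝ) * deMoivre m j a

theorem deMoivre_eq_coeff {R : Type*} [CommRing R] (n k : ℕ) (a : ℕ → R) :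
    deMoivre n k a = coeff n (tailSeries a ^ k) := rfl

theorem deMoivre_eq_zero {R : Type*} [CommRing R] {n k : ℕ} (h : n < k) (a : ℕ → R) :
    deMoivre n k a = 0 := by
  have hX : (X : PowerSeries R) ∣ tailSeries a := by
    rw [X_dvd_iff]
    simp [tailSeries]
  exact X_pow_dvd_iff.mp (pow_dvd_pow_of_dvd hX k) n h

theorem tailSeries_add (a b : ℕ → ℝ) : tailSeries (a + b) = tailSeries a + tailSeries b := by
  ext i
  by_cases h : i = 0 <;> simp [tailSeries, h]

theorem coeff_expSeries {m N : ℕ} (h : m < N) (a : ℕ → ℝ) :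
    coeff m (expSeries a) = ∑ j ∈ Finset.range N, 1 / (j.factorial : ℝ) * deMoivre m j a := by
  rw [expSeries, coeff_mk]
  refine Finset.sum_subset (Finset.range_subset_range.mpr h) fun j _ hj => ?_
  rw [deMoivre_eq_zero (by simpa using hj), mul_zero]

theorem constantCoeff_expSeries (a : ℕ → ℝ) : constantCoeff (expSeries a) = 1 := by
  rw [← coeff_zero_eq_constantCoeff_apply, expSeries, coeff_mk]
  simp [deMoivre]

theorem derivative_expSeries (a : ℕ → ℝ) :
    d⁄dX ℝ (expSeries a) = expSeries a * d⁄dX ℝ (tailSeries a) := by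
  ext m
  have key : ∀ j : ℕ, 1 / ((j + 1).factorial : ℝ) * deMoivre (m + 1) (j + 1) a * (m + 1) =
      1 / (j.factorial : ℝ) * coeff m (tailSeries a ^ j * d⁄dX ℝ (tailSeries a)) := by
    intro j
    have h := coeff_derivative (tailSeries a ^ (j + 1)) m
    rw [derivative_pow, Nat.add_sub_cancel, mul_assoc, ← map_natCast (C (R := ℝ)),
      coeff_C_mul] at h
    rw [mul_assoc, deMoivre_eq_coeff, ← h, Nat.factorial_succ]
    have h1 : (j.factorial : ℝ) ≠ 0 := by positivity
    have h2 : (j : ℝ) + 1 ≠ 0 := by positivity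
    push_cast
    field_simp
  rw [coeff_derivative, coeff_expSeries (Nat.lt_succ_self (m + 1)), Finset.sum_range_succ',
    deMoivre_eq_coeff (m + 1) 0]
  simp only [pow_zero, coeff_one, Nat.succ_ne_zero, if_false, mul_zero, add_zero]
  rw [Finset.sum_mul, Finset.sum_congr rfl fun j _ => key j]
  simp only [coeff_mul, Finset.mul_sum]
  rw [Finset.sum_comm]
  refine Finset.sum_congr rfl fun p hp => ?_
  have hp' : p.1 < m + 1 := by have := Finset.HasAntidiagonal.mem_antidiagonal.mp hp; omega
  rw [coeff_expSeries hp', Finset.sum_mul]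
  exact Finset.sum_congr rfl fun j _ => by rw [deMoivre_eq_coeff, mul_assoc]

/-- A formal power series is determined by its constant term and its logarithmic derivative. -/
theorem eq_of_derivative_eq_mul {P Q D : PowerSeries ℝ} (hP : d⁄dX ℝ P = P * D)
    (hQ : d⁄dX ℝ Q = Q * D) (h0 : constantCoeff P = constantCoeff Q) : P = Q := by
  ext n
  induction n using Nat.strong_induction_on with
  | _ n ih =>
    cases n with
    | zero => simpa using h0
    | succ n =>
      have h1 := congrArg (coeff n) hP
      have h2 := congrArg (coeff n) hQ
      rw [coeff_derivative, coeff_mul] at h1 h2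
      have h3 : coeff (n + 1) P * ((n : ℝ) + 1) = coeff (n + 1) Q * ((n : ℝ) + 1) := by
        rw [h1, h2]
        refine Finset.sum_congr rfl fun p hp => ?_
        rw [ih p.1 (by have := Finset.HasAntidiagonal.mem_antidiagonal.mp hp; omega)]
      exact mul_right_cancel₀ (by positivity) h3

theorem expSeries_add (a b : ℕ → ℝ) : expSeries (a + b) = expSeries a * expSeries b := by
  refine eq_of_derivative_eq_mul (derivative_expSeries (a + b)) ?_
    (by simp [constantCoeff_expSeries])
  rw [Derivation.leibniz, derivative_expSeries, derivative_expSeries, tailSeries_add, map_add]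
  simp only [smul_eq_mul]
  ring

theorem expSeries_zero : expSeries 0 = 1 := by
  refine eq_of_derivative_eq_mul (derivative_expSeries 0) (Q := 1) ?_
    (by simp [constantCoeff_expSeries])
  have : tailSeries (0 : ℕ → ℝ) = 0 := by ext i; simp [tailSeries]
  rw [this]
  simp

theorem expSeries_sum {ι : Type*} (s : Finset ι) (a : ι → ℕ → ℝ) :
    expSeries (∑ i ∈ s, a i) = ∏ i ∈ s, expSeries (a i) := by
  classical
  induction s using Finset.induction_on with
  | empty => simp [expSeries_zero]
  | insert i s hi ih => rw [Finset.sum_insert hi, Finset.prod_insert hi, expSeries_add, ih]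

/-- The coefficients `-c ^ k / k` of the formal logarithm of `1 - c * X`. -/
noncomputable def logCoeff (c : ℝ) (k : ℕ) : ℝ := -c ^ k / k

theorem expSeries_logCoeff (c : ℝ) : expSeries (logCoeff c) = 1 - C c * X := by
  refine eq_of_derivative_eq_mul (derivative_expSeries _) ?_ (by simp [constantCoeff_expSeries])
  have hD : d⁄dX ℝ (tailSeries (logCoeff c)) = PowerSeries.mk fun n => -c ^ (n + 1) := by
    ext n
    have : (n : ℝ) + 1 ≠ 0 := by positivity
    rw [coeff_derivative, tailSeries, coeff_mk, coeff_mk]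
    simp only [Nat.succ_ne_zero, if_false, logCoeff]
    push_cast
    field_simp
  rw [hD, map_sub, Derivation.map_one_eq_zero]
  ext n
  cases n with
  | zero => simp [sub_mul, mul_assoc]
  | succ n =>
    simp only [Derivation.leibniz, derivative_X, derivative_C, smul_eq_mul, mul_one,
      sub_mul, one_mul, map_sub, mul_assoc, coeff_C_mul, coeff_succ_X_mul, coeff_mk]
    simp
    ring

theorem expSeries_two_mul (a : ℕ → ℝ) : expSeries (fun k => 2 * a k) = expSeries a ^ 2 := by
  rw [sq, ← expSeries_add]
  congr 1
  ext k
  simp [two_mul]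

/-- De Moivre polynomials are homogeneous of degree `k`, and isobaric of weight `n`. -/
theorem deMoivre_twist (s t : ℝ) (n k : ℕ) (a : ℕ → ℝ) :
    deMoivre n k (fun i => s * t ^ i * a i) = s ^ k * t ^ n * deMoivre n k a := by
  have : tailSeries (fun i => s * t ^ i * a i) = C s * rescale t (tailSeries a) := by
    ext i
    rw [coeff_C_mul, coeff_rescale, tailSeries, tailSeries, coeff_mk, coeff_mk]
    split_ifs <;> ring
  rw [deMoivre_eq_coeff, deMoivre_eq_coeff, this, mul_pow, ← map_pow, ← map_pow, coeff_C_mul,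
    coeff_rescale, mul_assoc]

theorem deMoivre_ofReal (n k : ℕ) (a : ℕ → ℝ) :
    deMoivre n k (fun i => (a i : ℂ)) = ((deMoivre n k a : ℝ) : ℂ) := by
  have : tailSeries (fun i => (a i : ℂ)) = PowerSeries.map Complex.ofRealHom (tailSeries a) := by
    ext i
    rw [coeff_map, tailSeries, tailSeries, coeff_mk, coeff_mk]
    split_ifs <;> simp
  rw [deMoivre_eq_coeff, deMoivre_eq_coeff, this, ← map_pow, coeff_map]
  rfl

section Topology

open scoped PowerSeries.WithPiTopology

theorem tendsto_coeff_expSeries {a : ℕ → ℕ → ℝ} {b : ℕ → ℝ}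
    (h : ∀ i, i ≠ 0 → Tendsto (fun N => a N i) atTop (𝓝 (b i))) (m : ℕ) :
    Tendsto (fun N => coeff m (expSeries (a N))) atTop (𝓝 (coeff m (expSeries b))) := by
  have ht : Tendsto (fun N => tailSeries (a N)) atTop (𝓝 (tailSeries b)) := by
    rw [WithPiTopology.tendsto_iff_coeff_tendsto]
    intro i
    simp only [tailSeries, coeff_mk]
    split_ifs with hi
    · exact tendsto_const_nhds
    · exact h i hi
  simp only [expSeries, coeff_mk]
  refine tendsto_finsetSum _ fun j _ => Tendsto.const_mul _ ?_
  exact (WithPiTopology.tendsto_iff_coeff_tendsto ℝ _ _ _).mp (ht.pow j) m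

end Topology

/-! ### Growth of De Moivre polynomials of harmonic numbers -/

/-- The coefficients of `(a 1 * X + a 2 * X ^ 2 + ⋯) ^ k` are dominated by those of
`(h * X + h * X ^ 2 + ⋯) ^ k`. -/
theorem abs_deMoivre_le {a : ℕ → ℝ} {h : ℝ} (ha : ∀ i, i ≠ 0 → |a i| ≤ h) (n k : ℕ) :
    |deMoivre n k a| ≤ h ^ k * deMoivre n k (fun _ => (1 : ℝ)) := by
  have hh : 0 ≤ h := (abs_nonneg _).trans (ha 1 one_ne_zero)
  simp only [deMoivre_eq_coeff]
  induction k generalizing n with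
  | zero => simp [coeff_one]; split_ifs <;> simp
  | succ k ih =>
    rw [pow_succ (tailSeries a), pow_succ (tailSeries _), coeff_mul, coeff_mul, Finset.mul_sum]
    refine (Finset.abs_sum_le_sum_abs _ _).trans (Finset.sum_le_sum fun p _ => ?_)
    have h2 : |coeff p.2 (tailSeries a)| ≤ h * coeff p.2 (tailSeries fun _ => (1 : ℝ)) := by
      simp only [tailSeries, coeff_mk]
      split_ifs with hi
      · simp
      · simpa using ha _ hi
    rw [abs_mul]
    calc _ ≤ _ := mul_le_mul (ih p.1) h2 (abs_nonneg _) ((abs_nonneg _).trans (ih p.1))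
      _ = _ := by ring

theorem harmonicNumber_nonneg (k n : ℕ) : 0 ≤ harmonicNumber k n :=
  Finset.sum_nonneg fun i _ => by positivity

theorem harmonicNumber_le {k : ℕ} (hk : k ≠ 0) (n : ℕ) :
    harmonicNumber k n ≤ 1 + Real.log (n + 1) := by
  have h1 : harmonicNumber k n ≤ (harmonic n : ℝ) := by
    rw [harmonic_eq_sum_Icc]
    push_cast
    refine Finset.sum_le_sum fun i hi => ?_
    have hi1 : (1 : ℝ) ≤ i := by exact_mod_cast (Finset.mem_Icc.mp hi).1
    rw [one_div]
    exact inv_anti₀ (by linarith) (le_self_pow₀ hi1 hk)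
  refine (h1.trans (harmonic_le_one_add_log n)).trans ?_
  rcases Nat.eq_zero_or_pos n with rfl | hn
  · simp
  · have : (0 : ℝ) < n := by exact_mod_cast hn
    gcongr
    linarith

theorem exists_one_add_log_pow_le (l : ℕ) :
    ∃ K : ℝ, ∀ n : ℕ, (1 + Real.log (n + 1)) ^ l ≤ K * ((n : ℝ) + 1) ^ (1 / 2 : ℝ) := by
  -- The exponent is chosen so that `ε * l ≤ 1 / 2`, including at `l = 0`.
  set ε : ℝ := 1 / (2 * (l + 1)) with hε
  have hε0 : 0 < ε := by positivity
  refine ⟨(1 + 1 / ε) ^ l, fun n => ?_⟩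
  have hx : (1 : ℝ) ≤ n + 1 := by linarith [(Nat.cast_nonneg n : (0 : ℝ) ≤ n)]
  have hlog := Real.log_le_rpow_div (by linarith : (0 : ℝ) ≤ n + 1) hε0
  have h1 : 1 ≤ ((n : ℝ) + 1) ^ ε := Real.one_le_rpow hx hε0.le
  have h2 : 1 + Real.log (n + 1) ≤ (1 + 1 / ε) * ((n : ℝ) + 1) ^ ε := by
    rw [add_mul, one_mul, one_div_mul_eq_div]
    linarith
  calc (1 + Real.log (n + 1)) ^ l ≤ ((1 + 1 / ε) * ((n : ℝ) + 1) ^ ε) ^ l :=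
        pow_le_pow_left₀ (by linarith [Real.log_nonneg hx]) h2 l
    _ = (1 + 1 / ε) ^ l * ((n : ℝ) + 1) ^ (ε * l) := by
        rw [mul_pow, ← Real.rpow_mul_natCast (by linarith)]
    _ ≤ _ := by
        gcongr
        rw [hε, one_div_mul_eq_div, div_le_div_iff₀ (by positivity) (by norm_num)]
        linarith

theorem exists_abs_deMoivre_harmonicNumber_le (m l : ℕ) :
    ∃ K : ℝ, ∀ n : ℕ, |deMoivre m l (fun i => harmonicNumber i n / (i : ℝ))| ≤
      K * ((n : ℝ) + 1) ^ (1 / 2 : ℝ) := by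
  obtain ⟨K, hK⟩ := exists_one_add_log_pow_le l
  have hB : 0 ≤ deMoivre m l (fun _ => (1 : ℝ)) := by
    have := abs_deMoivre_le (a := fun _ => (1 : ℝ)) (h := 1) (by simp) m l
    rw [one_pow, one_mul] at this
    exact (abs_nonneg _).trans this
  refine ⟨K * deMoivre m l (fun _ => (1 : ℝ)), fun n => ?_⟩
  refine (abs_deMoivre_le (h := 1 + Real.log (n + 1)) (fun i hi => ?_) m l).trans ?_
  · rw [abs_of_nonneg (div_nonneg (harmonicNumber_nonneg _ _) (Nat.cast_nonneg _))]
    have : (1 : ℝ) ≤ i := by exact_mod_cast Nat.one_le_iff_ne_zero.mpr hi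
    exact (div_le_self (harmonicNumber_nonneg _ _) this).trans (harmonicNumber_le hi n)
  · calc _ ≤ _ := mul_le_mul_of_nonneg_right (hK n) hB
      _ = _ := by ring

theorem summable_inv_sq_mul_of_abs_le {f : ℕ → ℝ} {K : ℝ}
    (hf : ∀ n : ℕ, |f n| ≤ K * ((n : ℝ) + 1) ^ (1 / 2 : ℝ)) :
    Summable fun n : ℕ => 1 / ((n : ℝ) + 1) ^ 2 * f n := by
  have hs : Summable fun n : ℕ => ((n : ℝ) + 1) ^ (-(3 / 2) : ℝ) := by
    have := (summable_nat_add_iff 1).mpr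
      (Real.summable_nat_rpow.mpr (by norm_num : (-(3 / 2) : ℝ) < -1))
    simpa using this
  refine Summable.of_norm_bounded (hs.mul_left K) fun n => ?_
  have hx : (0 : ℝ) < n + 1 := by positivity
  rw [Real.norm_eq_abs, abs_mul, abs_of_nonneg (by positivity)]
  calc _ ≤ 1 / ((n : ℝ) + 1) ^ 2 * (K * ((n : ℝ) + 1) ^ (1 / 2 : ℝ)) := by gcongr; exact hf n
    _ = K * (((n : ℝ) + 1) ^ (1 / 2 : ℝ) / ((n : ℝ) + 1) ^ 2) := by ring
    _ = _ := by
      rw [← Real.rpow_natCast, ← Real.rpow_sub hx]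
      norm_num

/-! ### Harmonic numbers and products of linear factors -/

/-- The polynomial `(1 + X) (1 + X / 2) ⋯ (1 + X / n)`, as a power series. -/
noncomputable def harmonicProd (n : ℕ) : PowerSeries ℝ :=
  ∏ i ∈ Finset.range n, (1 + C (1 / ((i : ℝ) + 1)) * X)

theorem harmonicNumber_succ (k n : ℕ) :
    harmonicNumber k (n + 1) = harmonicNumber k n + 1 / ((n : ℝ) + 1) ^ k := by
  rw [harmonicNumber, Finset.sum_Icc_succ_top (by omega)]
  push_cast
  rfl

theorem harmonicNumber_eq_sum_range (k n : ℕ) :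
    harmonicNumber k n = ∑ i ∈ Finset.range n, 1 / ((i : ℝ) + 1) ^ k := by
  induction n with
  | zero => simp [harmonicNumber]
  | succ n ih => rw [harmonicNumber_succ, Finset.sum_range_succ, ih]

theorem harmonicProd_sq_eq_expSeries (n : ℕ) :
    harmonicProd n ^ 2 = expSeries (fun k => -2 * (-1) ^ k * (harmonicNumber k n / (k : ℝ))) := by
  have h : harmonicProd n =
      expSeries (∑ i ∈ Finset.range n, logCoeff (-(1 / ((i : ℝ) + 1)))) := by
    rw [expSeries_sum, harmonicProd]
    refine Finset.prod_congr rfl fun i _ => ?_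
    rw [expSeries_logCoeff, map_neg]
    ring
  rw [h, ← expSeries_two_mul]
  congr 1
  ext k
  rw [Finset.sum_apply, harmonicNumber_eq_sum_range, Finset.sum_div, Finset.mul_sum,
    Finset.mul_sum]
  refine Finset.sum_congr rfl fun i _ => ?_
  rw [logCoeff, neg_pow, one_div_pow]
  ring

theorem coeff_harmonicProd_sq (m n : ℕ) :
    coeff m (harmonicProd n ^ 2) = ∑ l ∈ Finset.range (m + 1),
      (-1 : ℝ) ^ (m - l) * ((2 : ℝ) ^ l / (l.factorial : ℝ)) *
        deMoivre m l (fun i => harmonicNumber i n / (i : ℝ)) := by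
  rw [harmonicProd_sq_eq_expSeries, coeff_expSeries (Nat.lt_succ_self m)]
  refine Finset.sum_congr rfl fun l hl => ?_
  obtain ⟨d, rfl⟩ := Nat.exists_eq_add_of_le (Nat.lt_succ_iff.mp (Finset.mem_range.mp hl))
  have hsign : (-1 : ℝ) ^ l * (-1) ^ l = 1 := by rw [← mul_pow]; norm_num
  rw [deMoivre_twist, Nat.add_sub_cancel_left, neg_pow, pow_add]
  linear_combination (1 / (l.factorial : ℝ) * 2 ^ l * (-1) ^ d *
    deMoivre (l + d) l (fun i => harmonicNumber i n / (i : ℝ))) * hsign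

theorem exists_abs_coeff_harmonicProd_sq_le (m : ℕ) :
    ∃ K : ℝ, ∀ n : ℕ, |coeff m (harmonicProd n ^ 2)| ≤ K * ((n : ℝ) + 1) ^ (1 / 2 : ℝ) := by
  choose K hK using exists_abs_deMoivre_harmonicNumber_le m
  refine ⟨∑ l ∈ Finset.range (m + 1), (2 : ℝ) ^ l / (l.factorial : ℝ) * K l, fun n => ?_⟩
  rw [coeff_harmonicProd_sq, Finset.sum_mul]
  refine (Finset.abs_sum_le_sum_abs _ _).trans (Finset.sum_le_sum fun l _ => ?_)
  rw [abs_mul, abs_mul, abs_pow, abs_neg, abs_one, one_pow, one_mul,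
    abs_of_nonneg (by positivity : (0 : ℝ) ≤ 2 ^ l / (l.factorial : ℝ)), mul_assoc]
  exact mul_le_mul_of_nonneg_left (hK l n) (by positivity)

/-- The coefficients `(2 ^ k - 2) H_N^{(k)} / k` of the formal logarithm of
`∏ i ≤ N, (1 - X / i) ^ 2 / (1 - 2 X / i)`. -/
noncomputable def gaussLogCoeff (N k : ℕ) : ℝ := (2 ^ k - 2) * harmonicNumber k N / k

theorem expSeries_gaussLogCoeff_zero : expSeries (gaussLogCoeff 0) = 1 := by
  rw [← expSeries_zero]
  congr 1
  ext k
  simp [gaussLogCoeff, harmonicNumber]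

theorem expSeries_gaussLogCoeff_succ (N : ℕ) :
    expSeries (gaussLogCoeff (N + 1)) * (1 - C (2 / ((N : ℝ) + 1)) * X) =
      expSeries (gaussLogCoeff N) * (1 - C (1 / ((N : ℝ) + 1)) * X) ^ 2 := by
  rw [← expSeries_logCoeff, ← expSeries_logCoeff, ← expSeries_two_mul, ← expSeries_add,
    ← expSeries_add]
  congr 1
  ext k
  simp only [Pi.add_apply, gaussLogCoeff, logCoeff, harmonicNumber_succ, div_pow, one_pow]
  ring

/-! ### The hypergeometric series with formal parameter -/

/-- The power series `(X)_n / n!`, where `(X)_n` is the rising factorial. -/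
noncomputable def risingSeries (n : ℕ) : PowerSeries ℝ :=
  ∏ i ∈ Finset.range n, C (1 / ((i : ℝ) + 1)) * (X + C (i : ℝ))

/-- The ratio `n! / (N + 1)_n`, with `(N + 1)_n` the rising factorial. -/
noncomputable def factorialRatio (N n : ℕ) : ℝ :=
  ∏ i ∈ Finset.range n, ((i : ℝ) + 1) / (N + 1 + i)

/-- The `n`-th term `((X)_n) ^ 2 / (n! (N + 1)_n)` of the hypergeometric series
`₂F₁(X, X; N + 1; 1)`. -/
noncomputable def gaussTerm (N n : ℕ) : PowerSeries ℝ :=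
  C (factorialRatio N n) * risingSeries n ^ 2

theorem factorialRatio_zero_left (n : ℕ) : factorialRatio 0 n = 1 := by
  refine Finset.prod_eq_one fun i _ => ?_
  have : (i : ℝ) + 1 ≠ 0 := by positivity
  rw [Nat.cast_zero, zero_add, add_comm, div_self]
  rwa [add_comm]

theorem factorialRatio_zero_right (N : ℕ) : factorialRatio N 0 = 1 := by simp [factorialRatio]

theorem factorialRatio_nonneg (N n : ℕ) : 0 ≤ factorialRatio N n :=
  Finset.prod_nonneg fun i _ => by positivity

theorem factorialRatio_succ_right (N n : ℕ) :
    factorialRatio N (n + 1) = factorialRatio N n * (((n : ℝ) + 1) / (N + 1 + n)) :=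
  Finset.prod_range_succ _ _

theorem factorialRatio_succ_left (N n : ℕ) :
    factorialRatio (N + 1) n = factorialRatio N n * (((N : ℝ) + 1) / (N + 1 + n)) := by
  induction n with
  | zero =>
    have : (N : ℝ) + 1 ≠ 0 := by positivity
    simp [factorialRatio, this]
  | succ n ih =>
    rw [factorialRatio_succ_right, factorialRatio_succ_right, ih]
    push_cast
    have h1 : (N : ℝ) + 1 + n ≠ 0 := by positivity
    have h2 : (N : ℝ) + 1 + (n + 1) ≠ 0 := by positivity
    have h3 : (N : ℝ) + 1 + 1 + n ≠ 0 := by positivity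
    field_simp
    ring

theorem factorialRatio_succ_right_le (N n : ℕ) :
    factorialRatio N (n + 1) ≤ 1 / ((N : ℝ) + 1) := by
  induction n with
  | zero => simp [factorialRatio]
  | succ n ih =>
    rw [factorialRatio_succ_right]
    refine (mul_le_of_le_one_right (factorialRatio_nonneg _ _) ?_).trans ih
    rw [div_le_one (by positivity)]
    linarith [(Nat.cast_nonneg N : (0 : ℝ) ≤ N)]

theorem factorialRatio_le_one (N n : ℕ) : factorialRatio N n ≤ 1 := by
  cases n with
  | zero => rw [factorialRatio_zero_right]
  | succ n =>
    refine (factorialRatio_succ_right_le N n).trans ?_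
    rw [div_le_one (by positivity)]
    linarith [(Nat.cast_nonneg N : (0 : ℝ) ≤ N)]

theorem risingSeries_succ (n : ℕ) :
    risingSeries (n + 1) = risingSeries n * (C (1 / ((n : ℝ) + 1)) * (X + C (n : ℝ))) :=
  Finset.prod_range_succ _ _

theorem risingSeries_succ_eq_harmonicProd (n : ℕ) :
    risingSeries (n + 1) = X * C (1 / ((n : ℝ) + 1)) * harmonicProd n := by
  induction n with
  | zero => simp [risingSeries, harmonicProd]
  | succ n ih =>
    have hW : harmonicProd (n + 1) = harmonicProd n * (1 + C (1 / ((n : ℝ) + 1)) * X) :=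
      Finset.prod_range_succ _ _
    have hC : C (1 / ((n : ℝ) + 1)) * C ((n : ℝ) + 1) = (1 : PowerSeries ℝ) := by
      rw [← map_mul, one_div_mul_cancel (by positivity), map_one]
    rw [risingSeries_succ, ih, hW]
    push_cast
    linear_combination (X * C (1 / ((n : ℝ) + 1 + 1)) * harmonicProd n) * hC

theorem gaussTerm_zero_right (N : ℕ) : gaussTerm N 0 = 1 := by
  simp [gaussTerm, factorialRatio, risingSeries]

theorem gaussTerm_zero_succ (n : ℕ) :
    gaussTerm 0 (n + 1) = X ^ 2 * (C (1 / ((n : ℝ) + 1) ^ 2) * harmonicProd n ^ 2) := by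
  rw [gaussTerm, factorialRatio_zero_left, risingSeries_succ_eq_harmonicProd, map_one,
    ← one_div_pow, map_pow]
  ring

theorem coeff_gaussTerm (N n k : ℕ) :
    coeff k (gaussTerm N n) = factorialRatio N n * coeff k (gaussTerm 0 n) := by
  rw [gaussTerm, gaussTerm, factorialRatio_zero_left, map_one, one_mul, coeff_C_mul]

theorem coeff_add_two_gaussTerm_zero_succ (n k : ℕ) :
    coeff (k + 2) (gaussTerm 0 (n + 1)) =
      1 / ((n : ℝ) + 1) ^ 2 * coeff k (harmonicProd n ^ 2) := by
  rw [gaussTerm_zero_succ, coeff_X_pow_mul, coeff_C_mul]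

theorem coeff_gaussTerm_zero_succ_of_lt {k : ℕ} (hk : k < 2) (n : ℕ) :
    coeff k (gaussTerm 0 (n + 1)) = 0 := by
  rw [gaussTerm_zero_succ]
  exact X_pow_dvd_iff.mp (dvd_mul_right _ _) k hk

theorem summable_coeff_gaussTerm_zero (k : ℕ) : Summable fun n => coeff k (gaussTerm 0 n) := by
  rw [← summable_nat_add_iff 1]
  rcases lt_or_ge k 2 with hk | hk
  · simp only [coeff_gaussTerm_zero_succ_of_lt hk]
    exact summable_zero
  · obtain ⟨k, rfl⟩ := Nat.exists_eq_add_of_le' hk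
    simp only [coeff_add_two_gaussTerm_zero_succ]
    obtain ⟨K, hK⟩ := exists_abs_coeff_harmonicProd_sq_le k
    exact summable_inv_sq_mul_of_abs_le hK

theorem abs_coeff_gaussTerm_le (N n k : ℕ) :
    |coeff k (gaussTerm N n)| ≤ |coeff k (gaussTerm 0 n)| := by
  rw [coeff_gaussTerm, abs_mul, abs_of_nonneg (factorialRatio_nonneg _ _)]
  exact mul_le_of_le_one_left (abs_nonneg _) (factorialRatio_le_one _ _)

theorem tendsto_natCast_mul_coeff_gaussTerm_zero (k : ℕ) :
    Tendsto (fun n : ℕ => (n : ℝ) * coeff k (gaussTerm 0 n)) atTop (𝓝 0) := by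
  rw [← tendsto_add_atTop_iff_nat 1]
  rcases lt_or_ge k 2 with hk | hk
  · simp only [coeff_gaussTerm_zero_succ_of_lt hk, mul_zero]
    exact tendsto_const_nhds
  · obtain ⟨k, rfl⟩ := Nat.exists_eq_add_of_le' hk
    obtain ⟨K, hK⟩ := exists_abs_coeff_harmonicProd_sq_le k
    have hlim : Tendsto (fun n : ℕ => K * ((n : ℝ) + 1) ^ (-(1 / 2) : ℝ)) atTop (𝓝 0) := by
      have := ((tendsto_rpow_neg_atTop (by norm_num : (0 : ℝ) < 1 / 2)).comp
        (tendsto_natCast_atTop_atTop.comp (tendsto_add_atTop_nat 1))).const_mul K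
      simpa [Function.comp_def] using this
    refine squeeze_zero_norm (fun n => ?_) hlim
    have hx : (0 : ℝ) < n + 1 := by positivity
    rw [coeff_add_two_gaussTerm_zero_succ, Real.norm_eq_abs, abs_mul, abs_mul,
      abs_of_nonneg (by positivity), abs_of_nonneg (by positivity)]
    push_cast
    calc _ ≤ ((n : ℝ) + 1) * (1 / ((n : ℝ) + 1) ^ 2 * (K * ((n : ℝ) + 1) ^ (1 / 2 : ℝ))) := by
          gcongr; exact hK n
      _ = K * (((n : ℝ) + 1) ^ (1 / 2 : ℝ) / ((n : ℝ) + 1) ^ (1 : ℝ)) := by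
          rw [Real.rpow_one]
          field_simp
      _ = _ := by
          rw [← Real.rpow_sub hx]
          norm_num

/-- Gauss's contiguous relation holds term by term up to a telescoping difference; the certificate
is `n` times the `n`-th term. -/
theorem gaussTerm_contiguous (N n : ℕ) :
    (1 - C (2 / ((N : ℝ) + 1)) * X) * gaussTerm N n -
        (1 - C (1 / ((N : ℝ) + 1)) * X) ^ 2 * gaussTerm (N + 1) n =
      C (1 / ((N : ℝ) + 1)) * (C (n : ℝ) * gaussTerm N n -
        C ((n + 1 : ℕ) : ℝ) * gaussTerm N (n + 1)) := by
  set c : ℝ := (N : ℝ) + 1 with hc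
  have hc0 : c ≠ 0 := by positivity
  have hcn : c + n ≠ 0 := by positivity
  have hn : (n : ℝ) + 1 ≠ 0 := by positivity
  have h1 : gaussTerm (N + 1) n = C (c / (c + n)) * gaussTerm N n := by
    rw [gaussTerm, gaussTerm, factorialRatio_succ_left, map_mul]
    ring
  have h2 : C ((n + 1 : ℕ) : ℝ) * gaussTerm N (n + 1) =
      C (1 / (c + n)) * (X + C (n : ℝ)) ^ 2 * gaussTerm N n := by
    have : ((n + 1 : ℕ) : ℝ) * (((n : ℝ) + 1) / (c + n)) * (1 / ((n : ℝ) + 1)) ^ 2 =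
        1 / (c + n) := by
      push_cast
      field_simp
    rw [← this, gaussTerm, gaussTerm, factorialRatio_succ_right, risingSeries_succ]
    simp only [map_mul, map_pow]
    ring
  have h3 : (C (1 / c) * C c : PowerSeries ℝ) = 1 := by
    rw [← map_mul, one_div_mul_cancel hc0, map_one]
  have h4 : (C (1 / (c + n)) * (C c + C (n : ℝ)) : PowerSeries ℝ) = 1 := by
    rw [← map_add, ← map_mul, one_div_mul_cancel hcn, map_one]
  have h5 : (C (2 / c) : PowerSeries ℝ) = 2 * C (1 / c) := by
    rw [← one_div_mul_eq_div, mul_comm, map_mul]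
    rfl
  have h6 : (C (c / (c + n)) : PowerSeries ℝ) = C c * C (1 / (c + n)) := by
    rw [← map_mul, mul_one_div]
  rw [h2, h1, h5, h6]
  generalize (C (1 / c) : PowerSeries ℝ) = u at *
  generalize (C (1 / (c + n)) : PowerSeries ℝ) = v at *
  generalize (C c : PowerSeries ℝ) = w at *
  generalize (C (n : ℝ) : PowerSeries ℝ) = z at *
  linear_combination (-(u * v * X ^ 2) - z * v) * gaussTerm N n * h3 +
    (2 * u * X - 1 + u * z) * gaussTerm N n * h4

/-! ### Gauss's summation by iterating the contiguous relation -/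

/-- The hypergeometric series `₂F₁(X, X; N + 1; 1)`, with coefficients given by convergent real
series. -/
noncomputable def gaussSeries (N : ℕ) : PowerSeries ℝ :=
  PowerSeries.mk fun k => ∑' n, coeff k (gaussTerm N n)

section Topology

open scoped PowerSeries.WithPiTopology

theorem hasSum_gaussTerm (N : ℕ) : HasSum (gaussTerm N) (gaussSeries N) := by
  rw [WithPiTopology.hasSum_iff_hasSum_coeff]
  intro k
  rw [gaussSeries, coeff_mk]
  exact (Summable.of_norm_bounded (summable_coeff_gaussTerm_zero k).abs
    fun n => abs_coeff_gaussTerm_le N n k).hasSum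

/-- The boundary term of the telescoping sum behind the contiguous relation vanishes. -/
theorem tendsto_natCast_mul_gaussTerm (N : ℕ) :
    Tendsto (fun n : ℕ => C (n : ℝ) * gaussTerm N n) atTop (𝓝 0) := by
  rw [WithPiTopology.tendsto_iff_coeff_tendsto]
  intro k
  rw [map_zero]
  refine squeeze_zero_norm (fun n => ?_)
    (tendsto_zero_iff_norm_tendsto_zero.mp (tendsto_natCast_mul_coeff_gaussTerm_zero k))
  rw [coeff_C_mul, norm_mul, norm_mul]
  exact mul_le_mul_of_nonneg_left (abs_coeff_gaussTerm_le N n k) (norm_nonneg _)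

theorem gaussSeries_contiguous (N : ℕ) :
    (1 - C (2 / ((N : ℝ) + 1)) * X) * gaussSeries N =
      (1 - C (1 / ((N : ℝ) + 1)) * X) ^ 2 * gaussSeries (N + 1) := by
  have h := ((hasSum_gaussTerm N).mul_left (1 - C (2 / ((N : ℝ) + 1)) * X)).sub
    ((hasSum_gaussTerm (N + 1)).mul_left ((1 - C (1 / ((N : ℝ) + 1)) * X) ^ 2))
  simp only [gaussTerm_contiguous] at h
  have h' := h.tendsto_sum_nat
  simp only [← Finset.mul_sum, Finset.sum_range_sub' (fun n : ℕ => C (n : ℝ) * gaussTerm N n)] at h'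
  have h0 := ((tendsto_natCast_mul_gaussTerm N).const_sub
    (C ((0 : ℕ) : ℝ) * gaussTerm N 0)).const_mul (C (1 / ((N : ℝ) + 1)))
  have := tendsto_nhds_unique h' h0
  rw [Nat.cast_zero, map_zero, zero_mul, sub_zero, mul_zero] at this
  exact sub_eq_zero.mp this

theorem gaussSeries_zero_eq (N : ℕ) :
    gaussSeries 0 = expSeries (gaussLogCoeff N) * gaussSeries N := by
  induction N with
  | zero => rw [expSeries_gaussLogCoeff_zero, one_mul]
  | succ N ih =>
    have hne : (1 - C (2 / ((N : ℝ) + 1)) * X : PowerSeries ℝ) ≠ 0 := by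
      intro h
      simpa using congrArg constantCoeff h
    refine mul_left_cancel₀ hne ?_
    rw [ih]
    linear_combination expSeries (gaussLogCoeff N) * gaussSeries_contiguous N -
      gaussSeries (N + 1) * expSeries_gaussLogCoeff_succ N

/-- For `n ≥ 1` the `n`-th term of `₂F₁(X, X; N + 1; 1)` is `O(1 / N)` times that of
`₂F₁(X, X; 1; 1)`, so in the limit only the term `1` at `n = 0` survives. -/
theorem tendsto_gaussSeries : Tendsto gaussSeries atTop (𝓝 1) := by
  rw [WithPiTopology.tendsto_iff_coeff_tendsto]
  intro k
  have hr : ∀ n, Tendsto (fun N => factorialRatio N n) atTop (𝓝 (if n = 0 then 1 else 0)) := by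
    intro n
    cases n with
    | zero => simp [factorialRatio_zero_right]
    | succ n =>
      rw [if_neg n.succ_ne_zero]
      exact squeeze_zero (fun N => factorialRatio_nonneg _ _)
        (fun N => factorialRatio_succ_right_le N n) tendsto_one_div_add_atTop_nhds_zero_nat
  have h := tendsto_tsum_of_dominated_convergence (𝓕 := atTop)
    (f := fun N n => coeff k (gaussTerm N n))
    (g := fun n => (if n = 0 then 1 else 0) * coeff k (gaussTerm 0 n))
    (summable_coeff_gaussTerm_zero k).abs
    (fun n => ((hr n).mul_const _).congr fun N => (coeff_gaussTerm N n k).symm)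
    (Eventually.of_forall fun N n => abs_coeff_gaussTerm_le N n k)
  rw [tsum_eq_single 0 (fun n hn => by rw [if_neg hn, zero_mul]), if_pos rfl, one_mul,
    gaussTerm_zero_right] at h
  simpa only [gaussSeries, coeff_mk] using h

end Topology

/-- The real sequence `(2 ^ k - 2) ζ(k) / k`, with value `0` at `k ≤ 1`. -/
noncomputable def realGaussZetaSeq (k : ℕ) : ℝ :=
  if k ≤ 1 then 0 else (2 ^ k - 2) * (∑' n : ℕ, 1 / ((n : ℝ) + 1) ^ k) / k

theorem ofReal_realGaussZetaSeq (k : ℕ) : (realGaussZetaSeq k : ℂ) = gaussZetaSeq k := by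
  rw [realGaussZetaSeq, gaussZetaSeq]
  split_ifs with hk
  · simp
  · have hk' : 1 < k := not_le.mp hk
    have hz := zeta_eq_tsum_one_div_nat_add_one_cpow (s := (k : ℂ)) (by simpa using hk')
    rw [hz]
    push_cast
    simp only [Complex.cpow_natCast]

theorem tendsto_gaussLogCoeff {k : ℕ} (hk : k ≠ 0) :
    Tendsto (fun N => gaussLogCoeff N k) atTop (𝓝 (realGaussZetaSeq k)) := by
  rcases Nat.lt_or_ge 1 k with hk1 | hk1
  · have hs : Summable fun n : ℕ => 1 / ((n : ℝ) + 1) ^ k := by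
      have := (summable_nat_add_iff 1).mpr (Real.summable_one_div_nat_pow.mpr hk1)
      simpa using this
    simp only [gaussLogCoeff, realGaussZetaSeq, if_neg (not_le.mpr hk1),
      harmonicNumber_eq_sum_range]
    exact (hs.hasSum.tendsto_sum_nat.const_mul _).div_const _
  · -- The factor `2 ^ 1 - 2 = 0` removes the divergent harmonic numbers of order `1`.
    obtain rfl : k = 1 := by omega
    simp [gaussLogCoeff, realGaussZetaSeq]

/-- Formal version of Gauss's evaluation `₂F₁(X, X; 1; 1) = Γ(1 - 2 X) / Γ(1 - X) ^ 2`. -/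
theorem gaussSeries_zero_eq_expSeries : gaussSeries 0 = expSeries realGaussZetaSeq := by
  open scoped PowerSeries.WithPiTopology in
  have h1 : Tendsto (fun N => expSeries (gaussLogCoeff N)) atTop
      (𝓝 (expSeries realGaussZetaSeq)) :=
    (WithPiTopology.tendsto_iff_coeff_tendsto ℝ _ _ _).mpr
      (tendsto_coeff_expSeries fun k hk => tendsto_gaussLogCoeff hk)
  have h2 := h1.mul tendsto_gaussSeries
  simp only [← gaussSeries_zero_eq, mul_one] at h2
  exact tendsto_nhds_unique tendsto_const_nhds h2

theorem coeff_add_two_gaussSeries_zero (m : ℕ) :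
    coeff (m + 2) (gaussSeries 0) =
      ∑' n : ℕ, 1 / ((n : ℝ) + 1) ^ 2 * coeff m (harmonicProd n ^ 2) := by
  rw [gaussSeries, coeff_mk, (summable_coeff_gaussTerm_zero (m + 2)).tsum_eq_zero_add,
    gaussTerm_zero_right, coeff_one, if_neg (by omega), zero_add]
  simp only [coeff_add_two_gaussTerm_zero_succ]

/-! ### Comparison of coefficients -/

theorem summable_deMoivre_harmonicNumber (m l : ℕ) : Summable fun n : ℕ =>
    1 / ((n : ℝ) + 1) ^ 2 * deMoivre m l (fun i => harmonicNumber i n / (i : ℝ)) := by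
  obtain ⟨K, hK⟩ := exists_abs_deMoivre_harmonicNumber_le m l
  exact summable_inv_sq_mul_of_abs_le hK

theorem proposition5p19 (m : ℕ) :
    (∀ l ∈ Finset.range (m + 1), Summable fun n : ℕ =>
        1 / ((n : ℝ) + 1) ^ 2 * deMoivre m l (fun i => harmonicNumber i n / (i : ℝ))) ∧
    ((∑ l ∈ Finset.range (m + 1), (-1 : ℝ) ^ (m - l) * ((2 : ℝ) ^ l / (l.factorial : ℝ)) *
        ∑' n : ℕ, 1 / ((n : ℝ) + 1) ^ 2 *
          deMoivre m l (fun i => harmonicNumber i n / (i : ℝ)) : ℝ) : ℂ) =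
      ∑ j ∈ Finset.range (m + 3), 1 / (j.factorial : ℂ) *
        deMoivre (m + 2) j gaussZetaSeq := by
  refine ⟨fun l _ => summable_deMoivre_harmonicNumber m l, ?_⟩
  have hz : gaussZetaSeq = fun k => (realGaussZetaSeq k : ℂ) :=
    funext fun k => (ofReal_realGaussZetaSeq k).symm
  have h : ∑ l ∈ Finset.range (m + 1), (-1 : ℝ) ^ (m - l) * ((2 : ℝ) ^ l / (l.factorial : ℝ)) *
        ∑' n : ℕ, 1 / ((n : ℝ) + 1) ^ 2 *
          deMoivre m l (fun i => harmonicNumber i n / (i : ℝ)) =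
      ∑ j ∈ Finset.range (m + 3), 1 / (j.factorial : ℝ) *
        deMoivre (m + 2) j realGaussZetaSeq := by
    rw [← coeff_expSeries (Nat.lt_succ_self (m + 2)), ← gaussSeries_zero_eq_expSeries,
      coeff_add_two_gaussSeries_zero]
    simp only [coeff_harmonicProd_sq, Finset.mul_sum, ← tsum_mul_left]
    rw [← Summable.tsum_finsetSum fun l _ =>
      (summable_deMoivre_harmonicNumber m l).mul_left _]
    exact tsum_congr fun n => Finset.sum_congr rfl fun l _ => by ring
  rw [h, hz]
  simp only [deMoivre_ofReal]
  push_cast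
  rfl
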